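/- Consider modal formulas built from countably many propositional variables $p_0,p_1,\dots$, $\bot$, $\to$ and $\Box$ (with $\neg\varphi=\varphi\to\bot$ and $\Diamond\varphi=\neg\Box\neg\varphi$). A normal modal logic is a set of formulas that contains all propositional tautologies and $\Box(p\to q)\to(\Box p\to\Box q)$ and is closed under modus ponens, generalization ($\varphi/\Box\varphi$) and substitution. Let $\mathbf{S5}$ be the smallest normal modal logic containing $\Box p\to p$ and $\Diamond p\to\Box\Diamond p$. A frame is a pair $F=(X,R)$ with $X\neq\varnothing$ and $R\subseteq X\times X$; $F\models\varphi$ means that $\varphi$ is valid in $F$ in Kripke semantics. For $n\ge 1$ let $\mathcal F_n$ be the set of frames with set of states $[n]=\{0,\dots,n-1\}$. For a set of formulas $L$ let $\operatorname{Fr}L$ be the class of frames that validate every formula of $L$, and let $L^{\mathbf{as}}$ be the set of formulas $\varphi$ that are valid asymptotically almost surely in a uniformly random element of $\mathcal F_n\cap\operatorname{Fr}L$, that is, $$\lim_{n\to\infty}\frac{|\mathcal F_n\cap\operatorname{Fr}L\cap\operatorname{Fr}\{\varphi\}|}{|\mathcal F_n\cap\operatorname{Fr}L|}=1 .$$ **Theorem.**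 $\mathbf{S5}^{\mathbf{as}}=\mathbf{S5}$. -/

import Mathlib

namespace ModalAS

/-- Formulas of the basic modal language: countably many propositional variables `p₀, p₁, …`,
falsum, implication, and the unary modality `□`. -/
inductive Formula : Type where
  | var : ℕ → Formula
  | bot : Formula
  | imp : Formula → Formula → Formula
  | box : Formula → Formula

namespace Formula

/-- `¬ φ` abbreviates `φ → ⊥`. -/
def neg (φ : Formula) : Formula := imp φ bot

/-- `◇ φ` abbreviates `¬ □ ¬ φ`. -/
def dia (φ : Formula) : Formula := neg (box (neg φ))

/-- `subst p θ φ` is the result of replacing all instances of the variable `p` in `φ` by `θ`. -/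
def subst (p : ℕ) (θ : Formula) : Formula → Formula
  | var q => if q = p then θ else var q
  | bot => bot
  | imp φ ψ => imp (subst p θ φ) (subst p θ ψ)
  | box φ => box (subst p θ φ)

/-- Boolean evaluation of a formula, where variables and boxed formulas are treated as atoms whose
truth values are given by `v`. -/
def boolEval (v : Formula → Prop) : Formula → Prop
  | var q => v (var q)
  | bot => False
  | imp φ ψ => boolEval v φ → boolEval v ψ
  | box φ => v (box φ)

/-- Propositional tautologies (in the modal language): formulas true under every assignment of
truth values to the variables and boxed formulas. -/
def IsTautology (φ : Formula) : Prop := ∀ v : Formula → Prop, boolEval v φ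

end Formula

open Formula

/-- A set of formulas is a normal modal logic if it contains all propositional tautologies and the
normality axiom `□(p → q) → (□p → □q)`, and is closed under modus ponens, generalization and
substitution. -/
structure IsNormalLogic (L : Set Formula) : Prop where
  taut : ∀ φ : Formula, IsTautology φ → φ ∈ L
  normality : imp (box (imp (var 0) (var 1))) (imp (box (var 0)) (box (var 1))) ∈ L
  mp : ∀ φ ψ : Formula, φ ∈ L → imp φ ψ ∈ L → ψ ∈ L
  gen : ∀ φ : Formula, φ ∈ L → box φ ∈ L
  sub : ∀ (φ : Formula) (p : ℕ) (θ : Formula), φ ∈ L → subst p θ φ ∈ L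

/-- The logic `S5`: the smallest normal modal logic that contains the reflexivity axiom `□p → p`
and the Euclidean axiom `◇p → □◇p`. -/
def S5 : Set Formula :=
  ⋂₀ {L : Set Formula | IsNormalLogic L ∧
      imp (box (var 0)) (var 0) ∈ L ∧
      imp (dia (var 0)) (box (dia (var 0))) ∈ L}

/-- Kripke frames: a nonempty set of states with a binary relation. -/
structure Frame : Type 1 where
  State : Type
  nonempty : Nonempty State
  Rel : State → State → Prop

/-- Truth of a formula at a state of the Kripke model on `F` with valuation `V`. -/
def Sat (F : Frame) (V : ℕ → F.State → Prop) : F.State → Formula → Prop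
  | w, var q => V q w
  | _, bot => False
  | w, imp φ ψ => Sat F V w φ → Sat F V w ψ
  | w, box φ => ∀ u : F.State, F.Rel w u → Sat F V u φ

/-- `F ⊨ φ`: the formula is true at every state under every valuation. -/
def Valid (F : Frame) (φ : Formula) : Prop :=
  ∀ (V : ℕ → F.State → Prop) (w : F.State), Sat F V w φ

/-- `Fr Γ`: the class of all frames that validate every formula of `Γ`. -/
def Fr (Γ : Set Formula) : Set Frame := {F | ∀ φ ∈ Γ, Valid F φ}

/-- The set of all frames whose set of states is `[n] = {0, …, n - 1}`
(empty for `n = 0`, since frames are nonempty). -/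
def labelledFrames (n : ℕ) : Set Frame :=
  {F | ∃ (h : Nonempty (Fin n)) (R : Fin n → Fin n → Prop), F = ⟨Fin n, h, R⟩}

theorem labelledFrames_finite (n : ℕ) : (labelledFrames n).Finite := by
  by_cases h : Nonempty (Fin n)
  · refine (Set.finite_range
      (fun R : Fin n → Fin n → Prop => (⟨Fin n, h, R⟩ : Frame))).subset ?_
    rintro F ⟨_, R, rfl⟩
    exact ⟨R, rfl⟩
  · refine Set.finite_empty.subset ?_
    rintro F ⟨h', _⟩
    exact h h'

/-- The probability that the uniformly distributed random element of the finite set of frames in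
`C` with set of states `[n]` belongs to `A`. -/
noncomputable def prob (C : Set Frame) (n : ℕ) (A : Set Frame) : ℝ :=
  ((labelledFrames n ∩ C ∩ A).ncard : ℝ) / ((labelledFrames n ∩ C).ncard : ℝ)

/-- The set of formulas that are asymptotically almost surely valid in the random `C`-frame with
`n` states. -/
def LogAS (C : Set Frame) : Set Formula :=
  {φ | Filter.Tendsto (fun n : ℕ => prob C n (Fr {φ})) Filter.atTop (nhds 1)}

/-- For a logic `L`, the set of almost sure validities in the class of frames of `L`. -/
def almostSure (L : Set Formula) : Set Formula := LogAS (Fr L)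

end ModalAS

namespace ModalAS

open Formula

/-! ### Soundness and the frames of `S5` -/

-- The frames of `S5` are the equivalence relations, so theorems of `S5` are valid with probability
-- 1. Conversely, if `φ ∉ S5`, a canonical model gives a finite cluster, of `k` assignments say,
-- that refutes `φ`. Any class with at least `k` points maps onto this cluster, so `φ` can be valid
-- only where all classes are smaller than `k` (`exists_class_bound`). Such relations are not
-- overwhelming: merging the classes of `k` fixed points creates a class of size at least `k`, and
-- the merged relation has boundedly many preimages, as only its restriction to at most `k * k`
-- points is lost (`ncard_le_of_class_lt`). So the probability of `φ` stays below a constant less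
-- than 1; no asymptotics of Bell numbers are needed.

theorem sat_iff_boolEval (F : Frame) (V : ℕ → F.State → Prop) (w : F.State) (φ : Formula) :
    Sat F V w φ ↔ boolEval (Sat F V w) φ := by
  induction φ with
  | var q => rfl
  | bot => rfl
  | imp φ ψ ihφ ihψ => exact imp_congr ihφ ihψ
  | box φ => rfl

theorem sat_subst (F : Frame) (V : ℕ → F.State → Prop) (p : ℕ) (θ φ : Formula) (w : F.State) :
    Sat F V w (subst p θ φ) ↔ Sat F (fun q u => if q = p then Sat F V u θ else V q u) w φ := by
  induction φ generalizing w with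
  | var q => by_cases h : q = p <;> simp [subst, Sat, h]
  | bot => rfl
  | imp φ ψ ihφ ihψ => exact imp_congr (ihφ w) (ihψ w)
  | box φ ih => exact forall_congr' fun u => imp_congr Iff.rfl (ih u)

theorem isNormalLogic_valid (F : Frame) : IsNormalLogic {φ | Valid F φ} where
  taut φ h V w := (sat_iff_boolEval F V w φ).2 (h _)
  normality _ _ h₁ h₂ u hu := h₁ u hu (h₂ u hu)
  mp _ _ h₁ h₂ V w := h₂ V w (h₁ V w)
  gen _ h V _ u _ := h V u
  sub φ p θ h V w := (sat_subst F V p θ φ w).2 (h _ w)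

theorem isNormalLogic_S5 : IsNormalLogic S5 where
  taut φ h _ hL := hL.1.taut φ h
  normality _ hL := hL.1.normality
  mp φ ψ h₁ h₂ _ hL := hL.1.mp φ ψ (h₁ _ hL) (h₂ _ hL)
  gen φ h _ hL := hL.1.gen φ (h _ hL)
  sub φ p θ h _ hL := hL.1.sub φ p θ (h _ hL)

theorem reflexivity_mem_S5 : imp (box (var 0)) (var 0) ∈ S5 := fun _ hL => hL.2.1

theorem euclidean_mem_S5 : imp (dia (var 0)) (box (dia (var 0))) ∈ S5 := fun _ hL => hL.2.2

theorem mem_Fr_S5_iff (F : Frame) : F ∈ Fr S5 ↔ Equivalence F.Rel := by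
  constructor
  · intro h
    have hrefl : ∀ x, F.Rel x x := fun x =>
      h _ reflexivity_mem_S5 (fun _ u => F.Rel x u) x fun _ hu => hu
    have heucl : ∀ x y z, F.Rel x y → F.Rel x z → F.Rel z y := by
      intro x y z hy hz
      by_contra hn
      refine h _ euclidean_mem_S5 (fun _ u => u = y) x (fun hb => hb y hy rfl) z hz ?_
      rintro u hu rfl
      exact hn hu
    have hsymm : ∀ {x y}, F.Rel x y → F.Rel y x := fun {x y} hxy =>
      heucl x x y (hrefl x) hxy
    exact ⟨hrefl, hsymm, fun {x y z} hxy hyz => heucl y z x hyz (hsymm hxy)⟩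
  · intro h φ hφ
    refine hφ {φ | Valid F φ} ⟨isNormalLogic_valid F, ?_, ?_⟩
    · exact fun V w hw => hw w (h.refl w)
    · intro V w hw u hu hn
      exact hw fun z hz => hn z (h.trans (h.symm hu) hz)

/-! ### Maximal theories -/

/-- A propositional theory: a set of formulas containing the tautologies and closed under modus
ponens. -/
structure IsTheory (T : Set Formula) : Prop where
  taut : ∀ φ : Formula, IsTautology φ → φ ∈ T
  mp : ∀ φ ψ : Formula, φ ∈ T → imp φ ψ ∈ T → ψ ∈ T

/-- A complete theory: membership commutes with the Boolean connectives. -/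
structure IsComplete (T : Set Formula) : Prop where
  bot : Formula.bot ∉ T
  imp : ∀ φ ψ : Formula, Formula.imp φ ψ ∈ T ↔ (φ ∈ T → ψ ∈ T)

theorem IsComplete.neg {T : Set Formula} (hT : IsComplete T) (φ : Formula) :
    φ.neg ∈ T ↔ φ ∉ T :=
  (hT.imp φ Formula.bot).trans (imp_congr Iff.rfl (iff_false_intro hT.bot))

theorem IsTheory.adjoin {T : Set Formula} (hT : IsTheory T) (χ : Formula) :
    IsTheory {ψ | imp χ ψ ∈ T} where
  taut _ h := hT.taut _ fun v _ => h v
  mp _ _ h₁ h₂ := hT.mp _ _ h₂ <| hT.mp _ _ h₁ <| hT.taut _ fun _ a b c => b c (a c)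

theorem IsTheory.exists_isComplete {T : Set Formula} (hT : IsTheory T) {φ : Formula}
    (hφ : φ ∉ T) : ∃ M, T ⊆ M ∧ IsComplete M ∧ φ ∉ M := by
  obtain ⟨M, hTM, hM⟩ := zorn_subset_nonempty {S : Set Formula | IsTheory S ∧ φ ∉ S}
    (by
      intro c hc hchain hne
      refine ⟨⋃₀ c, ⟨⟨?_, ?_⟩, ?_⟩, fun s hs => Set.subset_sUnion_of_mem hs⟩
      · obtain ⟨s, hs⟩ := hne
        exact fun ψ h => ⟨s, hs, (hc hs).1.taut ψ h⟩
      · rintro ψ χ ⟨s, hs, h₁⟩ ⟨t, ht, h₂⟩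
        rcases hchain.total hs ht with hst | hts
        · exact ⟨t, ht, (hc ht).1.mp _ _ (hst h₁) h₂⟩
        · exact ⟨s, hs, (hc hs).1.mp _ _ h₁ (hts h₂)⟩
      · rintro ⟨s, hs, h⟩
        exact (hc hs).2 h)
    T ⟨hT, hφ⟩
  obtain ⟨⟨hMt, hφM⟩, hmax⟩ := hM
  -- By maximality, adjoining any `χ ∉ M` must yield `φ`.
  have key : ∀ χ, χ ∉ M → imp χ φ ∈ M := by
    intro χ hχ
    by_contra hn
    refine hχ (hmax (y := {ψ | imp χ ψ ∈ M}) ⟨hMt.adjoin χ, hn⟩ ?_ ?_)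
    · exact fun ψ hψ => hMt.mp _ _ hψ (hMt.taut _ fun _ a _ => a)
    · exact hMt.taut _ fun _ a => a
  refine ⟨M, hTM, ⟨fun hb => hφM (hMt.mp _ _ hb (hMt.taut _ fun _ a => a.elim)), ?_⟩, hφM⟩
  refine fun χ ψ => ⟨fun h hχ => hMt.mp _ _ hχ h, fun h => ?_⟩
  by_cases hχ : χ ∈ M
  · exact hMt.mp _ _ (h hχ) (hMt.taut _ fun _ a _ => a)
  · by_contra hn
    -- The tautology `(χ → φ) → ((χ → ψ) → φ) → φ` would put `φ` in `M`.
    refine hφM (hMt.mp _ _ (key _ hn) (hMt.mp _ _ (key _ hχ) (hMt.taut _ fun v a b => ?_)))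
    by_contra hv
    exact hv (b fun c => (hv (a c)).elim)

/-! ### Derived theorems of `S5` -/

/-- A strict upper bound on the indices of the variables of a formula. -/
def varBound : Formula → ℕ
  | var q => q + 1
  | bot => 0
  | imp φ ψ => max (varBound φ) (varBound ψ)
  | box φ => varBound φ

theorem subst_eq_self {p : ℕ} (θ : Formula) {φ : Formula} (h : varBound φ ≤ p) :
    subst p θ φ = φ := by
  induction φ with
  | var q =>
    have : q ≠ p := by simp only [varBound] at h; omega
    simp [subst, this]
  | bot => rfl
  | imp φ ψ ihφ ihψ =>
    simp only [varBound, max_le_iff] at h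
    simp [subst, ihφ h.1, ihψ h.2]
  | box φ ih => simp [subst, ih h]

theorem S5_normality (φ ψ : Formula) :
    imp (box (imp φ ψ)) (imp (box φ) (box ψ)) ∈ S5 := by
  -- Substitution acts on one variable at a time: `var 0` is parked at a variable fresh for `ψ`, so
  -- that the final substitution of `φ` leaves `ψ` intact.
  obtain ⟨m, hm, hψ⟩ : ∃ m, 2 ≤ m ∧ varBound ψ ≤ m :=
    ⟨max 2 (varBound ψ), le_max_left _ _, le_max_right _ _⟩
  have h := isNormalLogic_S5.sub _ m φ <| isNormalLogic_S5.sub _ 1 ψ <|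
    isNormalLogic_S5.sub _ 0 (var m) isNormalLogic_S5.normality
  have hm1 : m ≠ 1 := by omega
  simpa [subst, hm1, subst_eq_self φ hψ] using h

theorem S5_reflexivity (φ : Formula) : imp (box φ) φ ∈ S5 := by
  simpa [subst] using isNormalLogic_S5.sub _ 0 φ reflexivity_mem_S5

theorem S5_euclidean (φ : Formula) : imp (dia φ) (box (dia φ)) ∈ S5 := by
  simpa [subst, dia, neg] using isNormalLogic_S5.sub _ 0 φ euclidean_mem_S5

theorem S5_box_mono {φ ψ : Formula} (h : imp φ ψ ∈ S5) : imp (box φ) (box ψ) ∈ S5 :=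
  isNormalLogic_S5.mp _ _ (isNormalLogic_S5.gen _ h) (S5_normality φ ψ)

theorem isTheory_S5 : IsTheory S5 := ⟨isNormalLogic_S5.taut, isNormalLogic_S5.mp⟩

theorem S5_imp_trans {φ ψ χ : Formula} (h₁ : imp φ ψ ∈ S5) (h₂ : imp ψ χ ∈ S5) :
    imp φ χ ∈ S5 :=
  isTheory_S5.mp _ _ h₂ <| isTheory_S5.mp _ _ h₁ <| isTheory_S5.taut _ fun _ a b c => b (a c)

theorem S5_contrapose {φ ψ : Formula} (h : imp φ ψ ∈ S5) : imp ψ.neg φ.neg ∈ S5 :=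
  isTheory_S5.mp _ _ h <| isTheory_S5.taut _ fun _ a b c => b (a c)

theorem S5_not_not_intro (φ : Formula) : imp φ φ.neg.neg ∈ S5 :=
  isTheory_S5.taut _ fun _ a b => b a

theorem S5_not_not_elim (φ : Formula) : imp φ.neg.neg φ ∈ S5 :=
  isTheory_S5.taut _ fun _ a => by_contra a

theorem S5_negative_introspection (φ : Formula) :
    imp (box φ).neg (box (box φ).neg) ∈ S5 :=
  S5_imp_trans (S5_contrapose (S5_box_mono (S5_not_not_elim φ))) <|
    S5_imp_trans (S5_euclidean φ.neg) <|
      S5_box_mono (S5_contrapose (S5_box_mono (S5_not_not_intro φ)))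

/-- The chain is `□φ → ◇□φ → □◇□φ → □□φ`. -/
theorem S5_positive_introspection (φ : Formula) : imp (box φ) (box (box φ)) ∈ S5 :=
  S5_imp_trans (S5_not_not_intro _) <|
    S5_imp_trans (S5_contrapose (S5_reflexivity (box φ).neg)) <|
      S5_imp_trans (S5_negative_introspection (box φ).neg) <|
        S5_box_mono <| S5_imp_trans (S5_contrapose (S5_negative_introspection φ)) <|
          S5_not_not_elim _

/-! ### Completeness of `S5` with respect to clusters -/

/-- Truth at the assignment `a` in the model whose states are the assignments in `A`, all of them
mutually accessible. -/
def ClusterSat (A : Set (ℕ → Prop)) : (ℕ → Prop) → Formula → Prop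
  | a, var q => a q
  | _, bot => False
  | a, imp φ ψ => ClusterSat A a φ → ClusterSat A a ψ
  | _, box φ => ∀ b ∈ A, ClusterSat A b φ

theorem exists_not_clusterSat {φ : Formula} (hφ : φ ∉ S5) :
    ∃ A : Set (ℕ → Prop), ∃ a ∈ A, ¬ ClusterSat A a φ := by
  obtain ⟨Γ, hΓ, hΓc, hφΓ⟩ := isTheory_S5.exists_isComplete hφ
  have hmp {T : Set Formula} (hT : IsComplete T) (hS : S5 ⊆ T) {α β : Formula}
      (h : imp α β ∈ S5) (hα : α ∈ T) : β ∈ T := (hT.imp α β).1 (hS h) hα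
  have hboxS5 {α : Formula} (h : α ∈ S5) : box α ∈ Γ := hΓ (isNormalLogic_S5.gen _ h)
  let C : Set (Set Formula) := {Δ | IsComplete Δ ∧ ∀ ψ, box ψ ∈ Γ → ψ ∈ Δ}
  let a : Set Formula → ℕ → Prop := fun Δ q => var q ∈ Δ
  -- By introspection all theories in `C` contain the same boxed formulas, so they form a single
  -- cluster.
  have hbox : ∀ Δ ∈ C, ∀ ψ, box ψ ∈ Δ ↔ box ψ ∈ Γ := by
    refine fun Δ hΔ ψ => ⟨fun h => ?_, fun h => ?_⟩
    · by_contra hn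
      exact (hΔ.1.neg _).1 (hΔ.2 _ (hmp hΓc hΓ (S5_negative_introspection ψ) ((hΓc.neg _).2 hn))) h
    · exact hΔ.2 _ (hmp hΓc hΓ (S5_positive_introspection ψ) h)
  have truth : ∀ ψ, ∀ Δ ∈ C, ClusterSat (a '' C) (a Δ) ψ ↔ ψ ∈ Δ := by
    intro ψ
    induction ψ with
    | var q => exact fun _ _ => Iff.rfl
    | bot => exact fun Δ hΔ => (iff_false_intro hΔ.1.bot).symm
    | imp χ ψ ihχ ihψ =>
      exact fun Δ hΔ => (imp_congr (ihχ Δ hΔ) (ihψ Δ hΔ)).trans (hΔ.1.imp χ ψ).symm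
    | box ψ ih =>
      intro Δ hΔ
      rw [hbox Δ hΔ]
      constructor
      · intro h
        by_contra hn
        have hT : IsTheory {χ | box χ ∈ Γ} :=
          ⟨fun χ h => hboxS5 (isTheory_S5.taut χ h), fun χ θ h₁ h₂ =>
            (hΓc.imp _ _).1 (hmp hΓc hΓ (S5_normality χ θ) h₂) h₁⟩
        obtain ⟨Θ, hsub, hΘ, hψ⟩ := hT.exists_isComplete (φ := ψ) hn
        have hΘC : Θ ∈ C := ⟨hΘ, fun _ h => hsub h⟩
        exact hψ ((ih Θ hΘC).1 (h _ ⟨Θ, hΘC, rfl⟩))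
      · rintro h _ ⟨Θ, hΘ, rfl⟩
        exact (ih Θ hΘ).2 (hΘ.2 _ h)
  have hΓC : Γ ∈ C := ⟨hΓc, fun ψ h => hmp hΓc hΓ (S5_reflexivity ψ) h⟩
  exact ⟨a '' C, a Γ, ⟨Γ, hΓC, rfl⟩, fun h => hφΓ ((truth φ Γ hΓC).1 h)⟩

/-- The assignment that agrees with `a` on the first `N` variables and is false elsewhere. -/
def truncate (N : ℕ) (a : ℕ → Prop) : ℕ → Prop := fun q => q < N ∧ a q

theorem finite_image_truncate (N : ℕ) (A : Set (ℕ → Prop)) : (truncate N '' A).Finite := by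
  refine (Set.finite_range fun (f : Fin N → Prop) (q : ℕ) => ∃ h : q < N, f ⟨q, h⟩).subset ?_
  rintro _ ⟨a, -, rfl⟩
  exact ⟨fun i => a i, by ext q; simp [truncate]⟩

theorem clusterSat_truncate {N : ℕ} (A : Set (ℕ → Prop)) {φ : Formula} (h : varBound φ ≤ N)
    (a : ℕ → Prop) : ClusterSat (truncate N '' A) (truncate N a) φ ↔ ClusterSat A a φ := by
  induction φ generalizing a with
  | var q => exact and_iff_right h
  | bot => rfl
  | imp φ ψ ihφ ihψ =>
    simp only [varBound, max_le_iff] at h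
    exact imp_congr (ihφ h.1 a) (ihψ h.2 a)
  | box φ ih =>
    exact Set.forall_mem_image.trans (forall₂_congr fun b _ => ih h b)

theorem exists_finite_not_clusterSat {φ : Formula} (hφ : φ ∉ S5) :
    ∃ A : Set (ℕ → Prop), A.Finite ∧ ∃ a ∈ A, ¬ ClusterSat A a φ := by
  obtain ⟨A, a, ha, h⟩ := exists_not_clusterSat hφ
  exact ⟨_, finite_image_truncate (varBound φ) A, _, ⟨a, ha, rfl⟩,
    fun h' => h ((clusterSat_truncate A le_rfl a).1 h')⟩

/-- On the class of `x`, `g` is a bounded morphism onto the cluster `A`: accessibility is total on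
both sides, so surjectivity suffices. -/
theorem sat_iff_clusterSat {F : Frame} (hF : Equivalence F.Rel) {A : Set (ℕ → Prop)}
    {x : F.State} {g : F.State → ℕ → Prop} (hg : g '' {y | F.Rel x y} = A) (φ : Formula)
    {y : F.State} (hy : F.Rel x y) :
    Sat F (fun q u => g u q) y φ ↔ ClusterSat A (g y) φ := by
  induction φ generalizing y with
  | var q => rfl
  | bot => rfl
  | imp φ ψ ihφ ihψ => exact imp_congr (ihφ hy) (ihψ hy)
  | box φ ih =>
    subst hg
    constructor
    · rintro h _ ⟨u, hu, rfl⟩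
      exact (ih hu).1 (h u (hF.trans (hF.symm hy) hu))
    · intro h u hu
      exact (ih (hF.trans hy hu)).2 (h _ ⟨u, hF.trans hy hu, rfl⟩)

theorem exists_image_eq_of_ncard_le {α β : Type*} {s : Set α} {t : Set β} (hs : s.Finite)
    (ht : t.Finite) (hne : t.Nonempty) (h : t.ncard ≤ s.ncard) : ∃ g : α → β, g '' s = t := by
  classical
  obtain ⟨b₀, hb₀⟩ := hne
  have : Nonempty β := ⟨b₀⟩
  obtain ⟨u, hus, hu⟩ := Set.exists_subset_card_eq h
  have : Nonempty α := by
    obtain ⟨x, -⟩ := (Set.ncard_pos (hs.subset hus)).1 (hu ▸ (Set.ncard_pos ht).2 ⟨b₀, hb₀⟩)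
    exact ⟨x⟩
  obtain ⟨f, hf⟩ := (ht.exists_bijOn_of_encard_eq (t := u) (by
    rw [← ht.cast_ncard_eq, ← (hs.subset hus).cast_ncard_eq, hu]))
  -- Invert the bijection `f` on `u` and send all surplus points to `b₀`.
  refine ⟨fun x => if x ∈ u then Function.invFunOn f t x else b₀, Set.Subset.antisymm ?_ ?_⟩
  · rintro _ ⟨x, -, rfl⟩
    dsimp only
    split_ifs with hx
    · exact Function.invFunOn_mem (hf.surjOn hx)
    · exact hb₀
  · intro b hb
    refine ⟨f b, hus (hf.mapsTo hb), ?_⟩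
    simp only [hf.mapsTo hb, if_true]
    exact hf.injOn.leftInvOn_invFunOn hb

/-- A formula outside `S5` is refuted in every equivalence frame with a large finite class. -/
theorem exists_class_bound {φ : Formula} (hφ : φ ∉ S5) :
    ∃ k : ℕ, 0 < k ∧ ∀ F : Frame, Finite F.State → Equivalence F.Rel → Valid F φ →
      ∀ x : F.State, {y | F.Rel x y}.ncard < k := by
  obtain ⟨A, hA, a, ha, hn⟩ := exists_finite_not_clusterSat hφ
  refine ⟨A.ncard, (Set.ncard_pos hA).2 ⟨a, ha⟩, fun F _ hF hv x => ?_⟩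
  by_contra hle
  obtain ⟨g, hg⟩ := exists_image_eq_of_ncard_le (Set.toFinite {y | F.Rel x y}) hA ⟨a, ha⟩
    (not_lt.1 hle)
  obtain ⟨y, hy, rfl⟩ := hg.symm ▸ ha
  exact hn ((sat_iff_clusterSat hF hg φ hy).1 (hv _ y))

/-! ### Counting equivalence relations -/

/-- The relation obtained from `R` by merging the classes that meet `I`. -/
def mergeRel {α : Type*} (R : α → α → Prop) (I : Set α) (x y : α) : Prop :=
  R x y ∨ (∃ i ∈ I, R i x) ∧ ∃ i ∈ I, R i y

theorem equivalence_mergeRel {α : Type*} {R : α → α → Prop} (hR : Equivalence R) (I : Set α) :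
    Equivalence (mergeRel R I) where
  refl x := Or.inl (hR.refl x)
  symm := Or.imp hR.symm And.symm
  trans := by
    rintro x y z (hxy | ⟨hx, hy⟩) (hyz | ⟨⟨j, hj, hjy⟩, hz⟩)
    · exact Or.inl (hR.trans hxy hyz)
    · exact Or.inr ⟨⟨j, hj, hR.trans hjy (hR.symm hxy)⟩, hz⟩
    · obtain ⟨i, hi, hiy⟩ := hy
      exact Or.inr ⟨hx, ⟨i, hi, hR.trans hiy hyz⟩⟩
    · exact Or.inr ⟨hx, hz⟩

theorem setOf_mergeRel {α : Type*} {R : α → α → Prop} (hR : Equivalence R) {I : Set α} {i : α}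
    (hi : i ∈ I) : {y | mergeRel R I i y} = {y | ∃ j ∈ I, R j y} := by
  ext y
  exact ⟨fun h => h.elim (fun h => ⟨i, hi, h⟩) And.right, fun h => Or.inr ⟨⟨i, hi, hR.refl i⟩, h⟩⟩

theorem ncard_setOf_exists_rel_le {α : Type*} [Finite α] {R : α → α → Prop} {k : ℕ}
    (hk : ∀ x, {y | R x y}.ncard ≤ k) (I : Set α) :
    {y | ∃ j ∈ I, R j y}.ncard ≤ I.ncard * k := by
  induction I, Set.toFinite I using Set.Finite.induction_on with
  | empty => simp
  | @insert i I hi _ ih =>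
    have : {y | ∃ j ∈ insert i I, R j y} = {y | R i y} ∪ {y | ∃ j ∈ I, R j y} := by
      ext y; simp
    rw [this, Set.ncard_insert_of_notMem hi, add_one_mul, add_comm]
    exact (Set.ncard_union_le _ _).trans (add_le_add (hk i) ih)

/-- If every member of `P` is an equivalence relation with all classes smaller than `k`, and `Q`
contains every equivalence relation with a class of size at least `k`, then `P` has at most a
constant times as many elements as `Q`. -/
theorem ncard_le_of_class_lt {n k : ℕ} (hk : 0 < k) (hkn : k ≤ n)
    (P Q : Set (Fin n → Fin n → Prop))
    (hP : ∀ R ∈ P, Equivalence R ∧ ∀ x, {y | R x y}.ncard < k)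
    (hQ : ∀ R, Equivalence R → (∃ x, k ≤ {y | R x y}.ncard) → R ∈ Q) :
    P.ncard ≤ Q.ncard * Nat.card (Fin (k * k) → Fin (k * k) → Prop) := by
  classical
  let I : Set (Fin n) := Set.range (Fin.castLE hkn)
  have hI : I.ncard = k := by
    simp only [I, ← Set.image_univ,
      Set.ncard_image_of_injective _ (Fin.castLE_injective hkn), Set.ncard_univ, Nat.card_fin]
  let i₀ : Fin n := Fin.castLE hkn ⟨0, hk⟩
  have hi₀ : i₀ ∈ I := ⟨_, rfl⟩
  -- The enumeration depends on the set alone, so two relations with the same merged class are read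
  -- through the same `e`.
  have hsurj : ∀ S : Set (Fin n), ∃ e : Fin (k * k) → Fin n,
      S.Nonempty → S.ncard ≤ k * k → Set.range e = S := by
    intro S
    by_cases h : S.Nonempty ∧ S.ncard ≤ k * k
    · obtain ⟨g, hg⟩ := exists_image_eq_of_ncard_le (s := (Set.univ : Set (Fin (k * k))))
        Set.finite_univ (Set.toFinite S) h.1 (by simpa using h.2)
      exact ⟨g, fun _ _ => by rw [← hg, Set.image_univ]⟩
    · exact ⟨fun _ => i₀, fun h₁ h₂ => (h ⟨h₁, h₂⟩).elim⟩
  choose e he using hsurj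
  let code : (Fin n → Fin n → Prop) →
      (Fin n → Fin n → Prop) × (Fin (k * k) → Fin (k * k) → Prop) := fun R =>
    (mergeRel R I, fun a b => R (e {y | mergeRel R I i₀ y} a) (e {y | mergeRel R I i₀ y} b))
  have hrange : ∀ R ∈ P, Set.range (e {y | mergeRel R I i₀ y}) = {y | mergeRel R I i₀ y} := by
    intro R hR
    obtain ⟨hE, hlt⟩ := hP R hR
    refine he _ ⟨i₀, (equivalence_mergeRel hE I).refl i₀⟩ ?_
    rw [setOf_mergeRel hE hi₀]
    exact (ncard_setOf_exists_rel_le (fun x => (hlt x).le) I).trans_eq (by rw [hI])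
  have hinj : Set.InjOn code P := by
    have aux : ∀ R ∈ P, ∀ R' ∈ P, code R = code R' → ∀ x y, R x y → R' x y := by
      intro R hR R' hR' h x y hxy
      obtain ⟨hm, hc⟩ := Prod.ext_iff.1 h
      change mergeRel R I = mergeRel R' I at hm
      have hE' := (hP R' hR').1
      -- Pairs outside the merged class are decided by the merged relation, pairs inside it by the
      -- recorded restriction.
      rcases (congrFun₂ hm x y).mp (Or.inl hxy) with h' | ⟨hx, hy⟩
      · exact h'
      · have hS := hrange R' hR'
        have hS' := setOf_mergeRel hE' hi₀
        obtain ⟨a, rfl⟩ : x ∈ Set.range (e {y | mergeRel R' I i₀ y}) := by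
          rw [hS, hS']; exact hx
        obtain ⟨b, rfl⟩ : y ∈ Set.range (e {y | mergeRel R' I i₀ y}) := by
          rw [hS, hS']; exact hy
        have hab := congrFun₂ hc a b
        simp only [code] at hab
        rw [hm] at hab
        exact hab.mp hxy
    intro R hR R' hR' h
    ext x y
    exact ⟨aux R hR R' hR' h x y, aux R' hR' R hR h.symm x y⟩
  have hmaps : Set.MapsTo code P (Q ×ˢ Set.univ) := by
    intro R hR
    obtain ⟨hE, -⟩ := hP R hR
    refine ⟨hQ _ (equivalence_mergeRel hE I) ⟨i₀, ?_⟩, trivial⟩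
    rw [setOf_mergeRel hE hi₀]
    refine hI.symm.le.trans (Set.ncard_le_ncard ?_ (Set.toFinite _))
    exact fun i hi => ⟨i, hi, hE.refl i⟩
  calc P.ncard ≤ (Q ×ˢ (Set.univ : Set (Fin (k * k) → Fin (k * k) → Prop))).ncard :=
        Set.ncard_le_ncard_of_injOn code hmaps hinj (Set.toFinite _)
    _ = _ := by rw [Set.ncard_prod, Set.ncard_univ]

/-! ### The almost sure logic of `S5` -/

theorem labelledFrames_inter_eq_image {n : ℕ} (h : Nonempty (Fin n)) (C : Set Frame) :
    labelledFrames n ∩ C = Frame.mk (Fin n) h '' {R | (⟨Fin n, h, R⟩ : Frame) ∈ C} := by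
  ext F
  constructor
  · rintro ⟨⟨_, R, rfl⟩, hC⟩
    exact ⟨R, hC, rfl⟩
  · rintro ⟨R, hC, rfl⟩
    exact ⟨⟨h, R, rfl⟩, hC⟩

theorem ncard_labelledFrames_inter {n : ℕ} (h : Nonempty (Fin n)) (C : Set Frame) :
    (labelledFrames n ∩ C).ncard = {R | (⟨Fin n, h, R⟩ : Frame) ∈ C}.ncard := by
  rw [labelledFrames_inter_eq_image h]
  refine Set.ncard_image_of_injective _ fun R R' hRR' => ?_
  simpa using hRR'

theorem ncard_labelledFrames_S5_pos {n : ℕ} (hn : 0 < n) :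
    0 < (labelledFrames n ∩ Fr S5).ncard := by
  refine (Set.ncard_pos ((labelledFrames_finite n).subset Set.inter_subset_left)).2 ?_
  exact ⟨⟨Fin n, ⟨⟨0, hn⟩⟩, Eq⟩, ⟨_, _, rfl⟩, (mem_Fr_S5_iff _).2 eq_equivalence⟩

theorem S5_subset_almostSure : S5 ⊆ almostSure S5 := by
  intro φ hφ
  refine tendsto_const_nhds.congr' ?_
  filter_upwards [Filter.eventually_gt_atTop 0] with n hn
  have hsub : labelledFrames n ∩ Fr S5 ⊆ Fr {φ} := by
    rintro F ⟨-, hF⟩ _ rfl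
    exact hF _ hφ
  have hpos := ncard_labelledFrames_S5_pos hn
  rw [prob, Set.inter_eq_left.2 hsub, div_self (by positivity)]

theorem exists_prob_le {φ : Formula} (hφ : φ ∉ S5) :
    ∃ c : ℝ, c < 1 ∧ ∀ᶠ n in Filter.atTop, prob (Fr S5) n (Fr {φ}) ≤ c := by
  obtain ⟨k, hk, hbound⟩ := exists_class_bound hφ
  obtain ⟨B, hB⟩ : ∃ B : ℕ, B = Nat.card (Fin (k * k) → Fin (k * k) → Prop) := ⟨_, rfl⟩
  -- If the valid frames number at most `B` times the refuting ones, their share of the total is at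
  -- most `B / (B + 1)`.
  refine ⟨B / (B + 1), (div_lt_one (by positivity)).2 (by linarith), ?_⟩
  filter_upwards [Filter.eventually_ge_atTop k] with n hn
  have h : Nonempty (Fin n) := ⟨⟨0, hk.trans_le hn⟩⟩
  have hle := ncard_le_of_class_lt hk hn
    {R | (⟨Fin n, h, R⟩ : Frame) ∈ Fr S5 ∩ Fr {φ}} {R | (⟨Fin n, h, R⟩ : Frame) ∈ Fr S5 \ Fr {φ}}
    (fun R hR => by
      have hE := (mem_Fr_S5_iff _).1 hR.1
      exact ⟨hE, hbound ⟨Fin n, h, R⟩ (inferInstanceAs (Finite (Fin n))) hE (hR.2 φ rfl)⟩)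
    (fun R hE ⟨x, hx⟩ => ⟨(mem_Fr_S5_iff _).2 hE, fun hv => hx.not_gt <|
      hbound ⟨Fin n, h, R⟩ (inferInstanceAs (Finite (Fin n))) hE (hv φ rfl) x⟩)
  rw [← hB, ← ncard_labelledFrames_inter h, ← ncard_labelledFrames_inter h, ← Set.inter_assoc,
    ← Set.inter_sdiff_assoc] at hle
  have hsum := Set.ncard_inter_add_ncard_sdiff_eq_ncard (labelledFrames n ∩ Fr S5) (Fr {φ})
    ((labelledFrames_finite n).subset Set.inter_subset_left)
  have hpos := ncard_labelledFrames_S5_pos (hk.trans_le hn)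
  rw [prob, div_le_div_iff₀ (by positivity) (by positivity)]
  have : (labelledFrames n ∩ Fr S5 ∩ Fr {φ}).ncard * (B + 1) ≤
      B * (labelledFrames n ∩ Fr S5).ncard := by
    rw [← hsum]; nlinarith
  exact_mod_cast this

theorem almostSure_subset_S5 : almostSure S5 ⊆ S5 := by
  intro φ hφ
  by_contra hn
  obtain ⟨c, hc, hle⟩ := exists_prob_le hn
  exact hc.not_ge (le_of_tendsto hφ hle)

end ModalAS

theorem theorem3p12 : ModalAS.almostSure ModalAS.S5 = ModalAS.S5 :=
  ModalAS.almostSure_subset_S5.antisymm ModalAS.S5_subset_almostSure
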